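/- Let $\mathcal A$ be a Desargues affine plane, that is, an affine plane (two distinct points lie on exactly one line; through a point not on a line $\ell$ there is exactly one line not meeting $\ell$; there are three non-collinear points) satisfying Desargues' axiom (both for three parallel lines and for three lines through one point). Let $O\neq I$ be points and let $\ell^{OI}$ be the line joining them. Points of $\ell^{OI}$ are multiplied as follows: fix a point $B_1\notin\ell^{OI}$; for $A,B\in\ell^{OI}$ let $P_1$ be the intersection of $\ell^{OB_1}$ with the parallel to $\ell^{IB_1}$ through $A$; then $A\cdot B$ is the intersection of $\ell^{OI}$ with the parallel to $\ell^{BB_1}$ through $P_1$. For $B\ne O$ let $B^{-1}$ be the (two-sided) inverse of $B$, i.e. the point with $B\cdot B^{-1}=B^{-1}\cdot B=I$, and define the ratio of $A,B\in\ell^{OI}$, $B\neq O$, by $r(A:B)=B^{-1}\cdot A$. For $P\in\ell^{OI}$ the inversion with $P$ is the map $j_P:\ell^{OI}\to\ell^{OI}$, $j_P(A)=P\cdot A$. Theorem. The ratio of two points is invariant under inversion with a given point: for every choice of $B_1\notin\ell^{OI}$, every $P\in\ell^{OI}$ with $P\neq O$ and all $A,B\in\ell^{OI}$ with $B\neq O$,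 one has $j_P(B)\neq O$, and $j_P(A)\ne j_P(B)$ if $A\neq B$, the inverses of $B$ and of $j_P(B)$ exist, and $$r(j_P(A):j_P(B))=r(P\cdot A:P\cdot B)=B^{-1}\cdot A=r(A:B).$$ -/

import Mathlib

universe u

/-- An affine plane on the set of points `Pt`: lines are sets of points, two different points lie on
exactly one line, Playfair's parallel axiom holds, and there are three non-collinear points. -/
structure AffPlane (Pt : Type u) where
  lines : Set (Set Pt)
  existsUnique_line : ∀ P Q : Pt, P ≠ Q → ∃! l : Set Pt, l ∈ lines ∧ P ∈ l ∧ Q ∈ l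
  existsUnique_disjoint : ∀ (P : Pt) (l : Set Pt), l ∈ lines → P ∉ l →
    ∃! l' : Set Pt, l' ∈ lines ∧ P ∈ l' ∧ l ∩ l' = ∅
  exists_noncollinear : ∃ P Q R : Pt, P ≠ Q ∧ Q ≠ R ∧ P ≠ R ∧
    ∀ l ∈ lines, ¬ (P ∈ l ∧ Q ∈ l ∧ R ∈ l)

namespace AffPlane

/-- Two lines are parallel if they are equal or do not meet. -/
def Par {Pt : Type u} (l m : Set Pt) : Prop := l = m ∨ l ∩ m = ∅

theorem Par.symm {Pt : Type u} {l m : Set Pt} (h : Par l m) : Par m l := by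
  rcases h with h | h
  · exact Or.inl h.symm
  · exact Or.inr (by rw [Set.inter_comm]; exact h)

theorem Par.eq_of_mem {Pt : Type u} {l m : Set Pt} (h : Par l m) {X : Pt} (hl : X ∈ l)
    (hm : X ∈ m) : l = m := by
  rcases h with h | h
  · exact h
  · have hX : X ∈ l ∩ m := ⟨hl, hm⟩
    rw [h] at hX
    exact hX.elim

theorem exists_mem_of_not_par {Pt : Type u} {l m : Set Pt} (h : ¬ Par l m) :
    ∃ X, X ∈ l ∧ X ∈ m := by
  by_contra hX
  push Not at hX
  exact h (Or.inr (Set.eq_empty_iff_forall_notMem.2 fun X hx => hX X hx.1 hx.2))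

variable {Pt : Type u} (𝒜 : AffPlane Pt)

/-- The line joining two different points `P` and `Q` (see `line_eq`). -/
def line (P Q : Pt) : Set Pt := {X | ∀ l ∈ 𝒜.lines, P ∈ l → Q ∈ l → X ∈ l}

theorem left_mem_line (P Q : Pt) : P ∈ 𝒜.line P Q := fun _ _ h _ => h

theorem right_mem_line (P Q : Pt) : Q ∈ 𝒜.line P Q := fun _ _ _ h => h

theorem line_eq {P Q : Pt} (h : P ≠ Q) {l : Set Pt} (hl : l ∈ 𝒜.lines) (hP : P ∈ l)
    (hQ : Q ∈ l) : 𝒜.line P Q = l := by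
  ext X
  refine ⟨fun hX => hX l hl hP hQ, fun hX m hm hPm hQm => ?_⟩
  rwa [(𝒜.existsUnique_line P Q h).unique ⟨hm, hPm, hQm⟩ ⟨hl, hP, hQ⟩]

theorem line_mem {P Q : Pt} (h : P ≠ Q) : 𝒜.line P Q ∈ 𝒜.lines := by
  obtain ⟨l, ⟨hl, hP, hQ⟩, -⟩ := 𝒜.existsUnique_line P Q h
  rwa [𝒜.line_eq h hl hP hQ]

/-- The line through the point `P` that is parallel to the line `l` (see `parallelThrough_eq`). -/
def parallelThrough (P : Pt) (l : Set Pt) : Set Pt :=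
  {X | ∀ m ∈ 𝒜.lines, P ∈ m → Par m l → X ∈ m}

theorem existsUnique_parallel (P : Pt) {l : Set Pt} (hl : l ∈ 𝒜.lines) :
    ∃! m : Set Pt, m ∈ 𝒜.lines ∧ P ∈ m ∧ Par m l := by
  by_cases hP : P ∈ l
  · exact ⟨l, ⟨hl, hP, Or.inl rfl⟩, fun m hm => hm.2.2.eq_of_mem hm.2.1 hP⟩
  · obtain ⟨m, ⟨hm, hPm, hd⟩, hu⟩ := 𝒜.existsUnique_disjoint P l hl hP
    refine ⟨m, ⟨hm, hPm, Par.symm (Or.inr hd)⟩, fun m' hm' => hu m' ⟨hm'.1, hm'.2.1, ?_⟩⟩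
    rcases hm'.2.2.symm with h | h
    · exact absurd (h ▸ hm'.2.1) hP
    · exact h

theorem parallelThrough_eq {P : Pt} {l m : Set Pt} (hl : l ∈ 𝒜.lines) (hm : m ∈ 𝒜.lines)
    (hP : P ∈ m) (h : Par m l) : 𝒜.parallelThrough P l = m := by
  ext X
  refine ⟨fun hX => hX m hm hP h, fun hX m' hm' hPm' hp => ?_⟩
  rwa [(𝒜.existsUnique_parallel P hl).unique ⟨hm', hPm', hp⟩ ⟨hm, hP, h⟩]

theorem parallelThrough_spec (P : Pt) {l : Set Pt} (hl : l ∈ 𝒜.lines) :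
    𝒜.parallelThrough P l ∈ 𝒜.lines ∧ P ∈ 𝒜.parallelThrough P l ∧
      Par (𝒜.parallelThrough P l) l := by
  obtain ⟨m, ⟨hm, hP, hp⟩, -⟩ := 𝒜.existsUnique_parallel P hl
  rw [𝒜.parallelThrough_eq hl hm hP hp]
  exact ⟨hm, hP, hp⟩

theorem par_trans {k l m : Set Pt} (hk : k ∈ 𝒜.lines) (hl : l ∈ 𝒜.lines) (hm : m ∈ 𝒜.lines)
    (h₁ : Par k l) (h₂ : Par l m) : Par k m := by
  by_contra h
  obtain ⟨X, hXk, hXm⟩ := exists_mem_of_not_par h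
  exact h (Or.inl ((𝒜.existsUnique_parallel X hl).unique ⟨hk, hXk, h₁⟩ ⟨hm, hXm, h₂.symm⟩))

/-- Desargues' axiom, for the three lines `AA'`, `BB'`, `CC'` either parallel or concurrent. -/
def IsDesarguesian : Prop :=
  ∀ A B C A' B' C' : Pt,
    A ≠ A' → B ≠ B' → C ≠ C' → A ≠ B → B ≠ C → A ≠ C → A' ≠ B' → B' ≠ C' → A' ≠ C' →
    [𝒜.line A A', 𝒜.line B B', 𝒜.line C C', 𝒜.line A C, 𝒜.line A' C'].Nodup →
    𝒜.line A B ≠ 𝒜.line A' B' → 𝒜.line B C ≠ 𝒜.line B' C' →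
    ((Par (𝒜.line A A') (𝒜.line B B') ∧ Par (𝒜.line B B') (𝒜.line C C')) ∨
      ∃ P : Pt, 𝒜.line A A' ∩ 𝒜.line B B' ∩ 𝒜.line C C' = {P}) →
    Par (𝒜.line A B) (𝒜.line A' B') → Par (𝒜.line B C) (𝒜.line B' C') →
    Par (𝒜.line A C) (𝒜.line A' C')

/-- The multiplication algorithm for points of the line `OI`, run with the auxiliary point `B₁`
off that line: the parallel to `IB₁` through `A` meets `OB₁` in `P₁`, and the parallel to `BB₁`
through `P₁` meets `OI` in `C`. -/
def IsProduct (O I B₁ A B C : Pt) : Prop :=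
  ∃ P₁ : Pt, P₁ ∈ 𝒜.parallelThrough A (𝒜.line I B₁) ∧ P₁ ∈ 𝒜.line O B₁ ∧
    C ∈ 𝒜.parallelThrough P₁ (𝒜.line B B₁) ∧ C ∈ 𝒜.line O I

theorem existsUnique_product {O I B₁ : Pt} (hOI : O ≠ I) (hB₁ : B₁ ∉ 𝒜.line O I)
    (A B : 𝒜.line O I) :
    ∃! C : 𝒜.line O I, 𝒜.IsProduct O I B₁ A B C := by
  have hO : O ∈ 𝒜.line O I := 𝒜.left_mem_line O I
  have hI : I ∈ 𝒜.line O I := 𝒜.right_mem_line O I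
  have hOB : O ≠ B₁ := fun h => hB₁ (h ▸ hO)
  have hIB : I ≠ B₁ := fun h => hB₁ (h ▸ hI)
  have hBB : (B : Pt) ≠ B₁ := fun h => hB₁ (h ▸ B.2)
  have lOI := 𝒜.line_mem hOI
  have lOB := 𝒜.line_mem hOB
  have lIB := 𝒜.line_mem hIB
  have lBB := 𝒜.line_mem hBB
  -- two lines that meet in two different points are equal
  have huniq : ∀ l ∈ 𝒜.lines, ∀ m ∈ 𝒜.lines, l ≠ m → ∀ X Y : Pt,
      X ∈ l → X ∈ m → Y ∈ l → Y ∈ m → X = Y := by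
    intro l hl m hm hlm X Y h1 h2 h3 h4
    by_contra hXY
    exact hlm ((𝒜.existsUnique_line X Y hXY).unique ⟨hl, h1, h3⟩ ⟨hm, h2, h4⟩)
  obtain ⟨lA, -, pA⟩ := 𝒜.parallelThrough_spec (A : Pt) lIB
  have n1 : ¬ Par (𝒜.parallelThrough A (𝒜.line I B₁)) (𝒜.line O B₁) := fun h => by
    have e := (𝒜.par_trans lIB lA lOB pA.symm h).eq_of_mem
      (𝒜.right_mem_line I B₁) (𝒜.right_mem_line O B₁)
    have e2 := 𝒜.line_eq hOI lOB (𝒜.left_mem_line O B₁) (e ▸ 𝒜.left_mem_line I B₁)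
    exact hB₁ (e2 ▸ 𝒜.right_mem_line O B₁)
  have n2 : ∀ P : Pt, ¬ Par (𝒜.parallelThrough P (𝒜.line B B₁)) (𝒜.line O I) := fun P h => by
    obtain ⟨lP, -, pP⟩ := 𝒜.parallelThrough_spec P lBB
    have e := (𝒜.par_trans lBB lP lOI pP.symm h).eq_of_mem (𝒜.left_mem_line B B₁) B.2
    exact hB₁ (e ▸ 𝒜.right_mem_line B B₁)
  obtain ⟨P₁, hP, hP'⟩ := exists_mem_of_not_par n1
  obtain ⟨C, hC, hC'⟩ := exists_mem_of_not_par (n2 P₁)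
  refine ⟨⟨C, hC'⟩, ⟨P₁, hP, hP', hC, hC'⟩, ?_⟩
  rintro ⟨D, hD⟩ ⟨Q₁, hQ, hQ', hD', -⟩
  have hPQ : Q₁ = P₁ := huniq _ lA _ lOB (fun h => n1 (Or.inl h)) _ _ hQ hQ' hP hP'
  subst hPQ
  exact Subtype.ext (huniq _ (𝒜.parallelThrough_spec Q₁ lBB).1 _ lOI
    (fun h => n2 Q₁ (Or.inl h)) _ _ hD' hD hC hC')

/-- The product `A · B` of points of the line `OI`. -/
noncomputable def mul {O I B₁ : Pt} (hOI : O ≠ I) (hB₁ : B₁ ∉ 𝒜.line O I)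
    (A B : 𝒜.line O I) : 𝒜.line O I :=
  (𝒜.existsUnique_product hOI hB₁ A B).choose

theorem mul_spec {O I B₁ : Pt} (hOI : O ≠ I) (hB₁ : B₁ ∉ 𝒜.line O I) (A B : 𝒜.line O I) :
    𝒜.IsProduct O I B₁ A B (𝒜.mul hOI hB₁ A B) :=
  (𝒜.existsUnique_product hOI hB₁ A B).choose_spec.1

/-- `X` is a two-sided inverse of `B` for the multiplication of points of the line `OI`. -/
def IsInverse {O I B₁ : Pt} (hOI : O ≠ I) (hB₁ : B₁ ∉ 𝒜.line O I) (B X : 𝒜.line O I) : Prop :=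
  (𝒜.mul hOI hB₁ B X : Pt) = I ∧ (𝒜.mul hOI hB₁ X B : Pt) = I

open Classical in
/-- The inverse `B⁻¹` of the point `B` of the line `OI` (the point `O` if `B` has no inverse). -/
noncomputable def inv {O I B₁ : Pt} (hOI : O ≠ I) (hB₁ : B₁ ∉ 𝒜.line O I)
    (B : 𝒜.line O I) : 𝒜.line O I :=
  if h : ∃ X, 𝒜.IsInverse hOI hB₁ B X then h.choose else ⟨O, 𝒜.left_mem_line O I⟩

/-- The ratio `r(A : B) = B⁻¹ · A` of two points of the line `OI`. -/
noncomputable def ratio {O I B₁ : Pt} (hOI : O ≠ I) (hB₁ : B₁ ∉ 𝒜.line O I)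
    (A B : 𝒜.line O I) : 𝒜.line O I :=
  𝒜.mul hOI hB₁ (𝒜.inv hOI hB₁ B) A

/-- The inversion `j_P : A ↦ P · A` of the line `OI`. -/
noncomputable def inversion {O I B₁ : Pt} (hOI : O ≠ I) (hB₁ : B₁ ∉ 𝒜.line O I)
    (P A : 𝒜.line O I) : 𝒜.line O I :=
  𝒜.mul hOI hB₁ P A

end AffPlane

/-!
For a point `A ≠ O` of the line `OI`, left multiplication `B ↦ A · B` is the restriction to `OI` of
the dilation with centre `O` that takes `I` to `A`: the auxiliary point `P₁` is the image of `B₁`,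
and `A · B` is the image of `B`. Associativity therefore says that a dilation with centre `O` is
determined by the image of one point.

Only points of the two lines `OI` and `OB₁` occur in the products, so the required closure
property is about four pairs of points on two lines (`par_of_two_lines`). Desargues' axiom speaks
of three lines, so the dilation is extended to an auxiliary third line through `O` and Desargues'
axiom is applied four times, each time in the form `par_of_concurrent`.

With associativity (`mul_assoc'`), the unit `I` and explicit left and right inverses, the points
of `OI` other than `O` form a group, and
`(P · B)⁻¹ · (P · A) = ((P · B)⁻¹ · P) · A = B⁻¹ · A`,
since `(P · B)⁻¹ · P` is a left inverse of `B`. The point `A = O` is allowed throughout, so products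
with `O` are computed as well.
-/

namespace AffPlane

variable {Pt : Type u} (𝒜 : AffPlane Pt)

/-! ### Incidence and parallels -/

theorem line_comm (P Q : Pt) : 𝒜.line P Q = 𝒜.line Q P := by
  ext X
  exact ⟨fun h l hl hQ hP => h l hl hP hQ, fun h l hl hP hQ => h l hl hQ hP⟩

variable {𝒜}

theorem notMem_of_mem_ne {O X : Pt} {l m : Set Pt} (hl : l ∈ 𝒜.lines) (hm : m ∈ 𝒜.lines)
    (hlm : l ≠ m) (hOl : O ∈ l) (hOm : O ∈ m) (hX : X ∈ l) (hXO : X ≠ O) : X ∉ m := fun h =>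
  hlm ((𝒜.existsUnique_line X O hXO).unique ⟨hl, hX, hOl⟩ ⟨hm, h, hOm⟩)

theorem Par.trans {k l m : Set Pt} (h₁ : Par k l) (h₂ : Par l m) (hk : k ∈ 𝒜.lines)
    (hl : l ∈ 𝒜.lines) (hm : m ∈ 𝒜.lines) : Par k m :=
  𝒜.par_trans hk hl hm h₁ h₂

theorem mem_parallelThrough {X Y : Pt} {l : Set Pt} (h : Par (𝒜.line X Y) l) (hXY : X ≠ Y)
    (hl : l ∈ 𝒜.lines) : Y ∈ 𝒜.parallelThrough X l := by
  rw [𝒜.parallelThrough_eq hl (𝒜.line_mem hXY) (𝒜.left_mem_line X Y) h]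
  exact 𝒜.right_mem_line X Y

/-- A line through a point `X` off the line `m` is determined by its direction, and meets `m` at
most once. -/
theorem eq_of_par_line {X Y Y' : Pt} {m : Set Pt} (hm : m ∈ 𝒜.lines) (hX : X ∉ m) (hY : Y ∈ m)
    (hY' : Y' ∈ m) (h : Par (𝒜.line X Y) (𝒜.line X Y')) : Y = Y' := by
  by_contra hne
  have hXY : X ≠ Y := fun e => hX (e ▸ hY)
  have e := h.eq_of_mem (𝒜.left_mem_line X Y) (𝒜.left_mem_line X Y')
  have e' := 𝒜.line_eq hne (𝒜.line_mem hXY) (𝒜.right_mem_line X Y)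
    (e ▸ 𝒜.right_mem_line X Y')
  exact hX (𝒜.line_eq hne hm hY hY' ▸ e' ▸ 𝒜.left_mem_line X Y)

/-! ### Dilations with a fixed centre -/

/-- The image of `Y ∈ m` under the dilation with centre `O` that takes `X ∈ l` to `X' ∈ l`. -/
theorem exists_par_line {O X X' Y : Pt} {l m : Set Pt} (hl : l ∈ 𝒜.lines) (hm : m ∈ 𝒜.lines)
    (hlm : l ≠ m) (hOl : O ∈ l) (hOm : O ∈ m) (hX : X ∈ l) (hXO : X ≠ O) (hX' : X' ∈ l)
    (hX'O : X' ≠ O) (hY : Y ∈ m) (hYO : Y ≠ O) :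
    ∃ Y' ∈ m, Y' ≠ O ∧ Par (𝒜.line X Y) (𝒜.line X' Y') := by
  have hXm := notMem_of_mem_ne hl hm hlm hOl hOm hX hXO
  have hX'm := notMem_of_mem_ne hl hm hlm hOl hOm hX' hX'O
  have hYl := notMem_of_mem_ne hm hl hlm.symm hOm hOl hY hYO
  have hXY : X ≠ Y := fun e => hXm (e ▸ hY)
  obtain ⟨lp, hX'p, pp⟩ := 𝒜.parallelThrough_spec X' (𝒜.line_mem hXY)
  have hnp : ¬ Par (𝒜.parallelThrough X' (𝒜.line X Y)) m := fun h => by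
    have e := (pp.symm.trans h (𝒜.line_mem hXY) lp hm).eq_of_mem (𝒜.right_mem_line X Y) hY
    exact hXm (e ▸ 𝒜.left_mem_line X Y)
  obtain ⟨Y', hY'p, hY'⟩ := exists_mem_of_not_par hnp
  refine ⟨Y', hY', ?_, ?_⟩
  · rintro rfl
    have e := (𝒜.existsUnique_line X' Y' hX'O).unique ⟨lp, hX'p, hY'p⟩ ⟨hl, hX', hOl⟩
    rw [e] at pp
    exact hYl (pp.eq_of_mem hX (𝒜.left_mem_line X Y) ▸ 𝒜.right_mem_line X Y)
  · rw [𝒜.line_eq (fun e => hX'm (by rwa [e]) : X' ≠ Y') lp hX'p hY'p]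
    exact pp.symm

/-- Desargues' axiom for triangles in perspective from `O`. All non-degeneracy conditions of
`IsDesarguesian` follow from the three lines being different, apart from `X ≠ X'`; if `X = X'`, the
triangles coincide. -/
theorem par_of_concurrent (h𝒜 : 𝒜.IsDesarguesian) {O X X' Y Y' Z Z' : Pt} {l m n : Set Pt}
    (hl : l ∈ 𝒜.lines) (hm : m ∈ 𝒜.lines) (hn : n ∈ 𝒜.lines)
    (hlm : l ≠ m) (hmn : m ≠ n) (hln : l ≠ n) (hOl : O ∈ l) (hOm : O ∈ m) (hOn : O ∈ n)
    (hX : X ∈ l) (hX' : X' ∈ l) (hY : Y ∈ m) (hY' : Y' ∈ m) (hZ : Z ∈ n) (hZ' : Z' ∈ n)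
    (hXO : X ≠ O) (hXO' : X' ≠ O) (hYO : Y ≠ O) (hYO' : Y' ≠ O) (hZO : Z ≠ O) (hZO' : Z' ≠ O)
    (hXY : Par (𝒜.line X Y) (𝒜.line X' Y')) (hYZ : Par (𝒜.line Y Z) (𝒜.line Y' Z')) :
    Par (𝒜.line X Z) (𝒜.line X' Z') := by
  have Xm := notMem_of_mem_ne hl hm hlm hOl hOm hX hXO
  have Xm' := notMem_of_mem_ne hl hm hlm hOl hOm hX' hXO'
  have Xn := notMem_of_mem_ne hl hn hln hOl hOn hX hXO
  have Xn' := notMem_of_mem_ne hl hn hln hOl hOn hX' hXO'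
  have Yl := notMem_of_mem_ne hm hl hlm.symm hOm hOl hY hYO
  have Yn := notMem_of_mem_ne hm hn hmn hOm hOn hY hYO
  have Yn' := notMem_of_mem_ne hm hn hmn hOm hOn hY' hYO'
  have Zl := notMem_of_mem_ne hn hl hln.symm hOn hOl hZ hZO
  have Zl' := notMem_of_mem_ne hn hl hln.symm hOn hOl hZ' hZO'
  have Zm := notMem_of_mem_ne hn hm hmn.symm hOn hOm hZ hZO
  have nXY : X ≠ Y := fun e => Xm (e ▸ hY)
  have nXY' : X' ≠ Y' := fun e => Xm' (e ▸ hY')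
  have nYZ : Y ≠ Z := fun e => Yn (e ▸ hZ)
  have nYZ' : Y' ≠ Z' := fun e => Yn' (e ▸ hZ')
  have nXZ : X ≠ Z := fun e => Xn (e ▸ hZ)
  have nXZ' : X' ≠ Z' := fun e => Xn' (e ▸ hZ')
  by_cases hXX : X = X'
  · subst hXX
    obtain rfl := eq_of_par_line hm Xm hY hY' hXY
    obtain rfl := eq_of_par_line hn Yn hZ hZ' hYZ
    exact Or.inl rfl
  have hYY : Y ≠ Y' := by
    rintro rfl
    rw [𝒜.line_comm X, 𝒜.line_comm X'] at hXY
    exact hXX (eq_of_par_line hl Yl hX hX' hXY)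
  have hZZ : Z ≠ Z' := by
    rintro rfl
    rw [𝒜.line_comm Y, 𝒜.line_comm Y'] at hYZ
    exact hYY (eq_of_par_line hm Zm hY hY' hYZ)
  have el := 𝒜.line_eq hXX hl hX hX'
  have em := 𝒜.line_eq hYY hm hY hY'
  have en := 𝒜.line_eq hZZ hn hZ hZ'
  refine h𝒜 X Y Z X' Y' Z' hXX hYY hZZ nXY nYZ nXZ nXY' nYZ' nXZ' ?_ ?_ ?_
    (Or.inr ⟨O, ?_⟩) hXY hYZ
  · have h1 : l ≠ 𝒜.line X Z := fun e => Zl (e ▸ 𝒜.right_mem_line X Z)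
    have h2 : l ≠ 𝒜.line X' Z' := fun e => Zl' (e ▸ 𝒜.right_mem_line X' Z')
    have h3 : m ≠ 𝒜.line X Z := fun e => Xm (e ▸ 𝒜.left_mem_line X Z)
    have h4 : m ≠ 𝒜.line X' Z' := fun e => Xm' (e ▸ 𝒜.left_mem_line X' Z')
    have h5 : n ≠ 𝒜.line X Z := fun e => Xn (e ▸ 𝒜.left_mem_line X Z)
    have h6 : n ≠ 𝒜.line X' Z' := fun e => Xn' (e ▸ 𝒜.left_mem_line X' Z')
    have h7 : 𝒜.line X Z ≠ 𝒜.line X' Z' := fun e => h1 <|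
      (𝒜.line_eq hXX hl hX hX').symm.trans <| 𝒜.line_eq hXX (𝒜.line_mem nXZ)
        (𝒜.left_mem_line X Z) (e ▸ 𝒜.left_mem_line X' Z')
    rw [el, em, en]
    simp [hlm, hln, hmn, h1, h2, h3, h4, h5, h6, h7]
  · intro e
    have e' := 𝒜.line_eq hXX (𝒜.line_mem nXY) (𝒜.left_mem_line X Y)
      (e ▸ 𝒜.left_mem_line X' Y')
    exact Yl (el ▸ e' ▸ 𝒜.right_mem_line X Y)
  · intro e
    have e' := 𝒜.line_eq hYY (𝒜.line_mem nYZ) (𝒜.left_mem_line Y Z)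
      (e ▸ 𝒜.left_mem_line Y' Z')
    exact Zm (em ▸ e' ▸ 𝒜.right_mem_line Y Z)
  · rw [el, em, en]
    ext W
    refine ⟨fun h => ?_, ?_⟩
    · by_contra hW
      exact notMem_of_mem_ne hl hm hlm hOl hOm h.1.1 hW h.1.2
    · rintro rfl
      exact ⟨⟨hOl, hOm⟩, hOn⟩

theorem exists_third_line {O X V : Pt} {l m : Set Pt} (hl : l ∈ 𝒜.lines) (hm : m ∈ 𝒜.lines)
    (hlm : l ≠ m) (hOl : O ∈ l) (hOm : O ∈ m) (hX : X ∈ l) (hXO : X ≠ O) (hV : V ∈ m)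
    (hVO : V ≠ O) :
    ∃ n ∈ 𝒜.lines, l ≠ n ∧ m ≠ n ∧ O ∈ n ∧ ∃ Q ∈ n, Q ≠ O := by
  have Xm := notMem_of_mem_ne hl hm hlm hOl hOm hX hXO
  have Vl := notMem_of_mem_ne hm hl hlm.symm hOm hOl hV hVO
  have lXV := 𝒜.line_mem (fun e => Xm (e ▸ hV) : X ≠ V)
  -- the parallel to `XV` through `O`, and its intersection with the parallel to `l` through `V`
  obtain ⟨ln, hOn, pn⟩ := 𝒜.parallelThrough_spec O lXV
  obtain ⟨lk, hVk, pk⟩ := 𝒜.parallelThrough_spec V hl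
  have hln : l ≠ 𝒜.parallelThrough O (𝒜.line X V) := fun e => by
    rw [← e] at pn
    exact Vl (pn.eq_of_mem hX (𝒜.left_mem_line X V) ▸ 𝒜.right_mem_line X V)
  refine ⟨_, ln, hln, fun e => ?_, hOn, ?_⟩
  · rw [← e] at pn
    exact Xm (pn.eq_of_mem hV (𝒜.right_mem_line X V) ▸ 𝒜.left_mem_line X V)
  · obtain ⟨Q, hQk, hQn⟩ := exists_mem_of_not_par
      (fun h => hln ((pk.symm.trans h hl lk ln).eq_of_mem hOl hOn) :
        ¬ Par (𝒜.parallelThrough V l) (𝒜.parallelThrough O (𝒜.line X V)))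
    refine ⟨Q, hQn, ?_⟩
    rintro rfl
    exact Vl (pk.eq_of_mem hQk hOl ▸ hVk)

/-- If the dilation with centre `O` that takes `X` to `X'` takes `U` to `U'` and `V` to `V'`, and
the one that takes `U` to `U'` takes `E` to `E'`, then the latter takes `V` to `V'` as well. -/
theorem par_of_two_lines (h𝒜 : 𝒜.IsDesarguesian) {O X X' E E' U U' V V' : Pt} {l m : Set Pt}
    (hl : l ∈ 𝒜.lines) (hm : m ∈ 𝒜.lines) (hlm : l ≠ m) (hOl : O ∈ l) (hOm : O ∈ m)
    (hX : X ∈ l) (hX' : X' ∈ l) (hE : E ∈ l) (hE' : E' ∈ l)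
    (hU : U ∈ m) (hU' : U' ∈ m) (hV : V ∈ m) (hV' : V' ∈ m)
    (hXO : X ≠ O) (hXO' : X' ≠ O) (hEO : E ≠ O) (hEO' : E' ≠ O)
    (hUO : U ≠ O) (hUO' : U' ≠ O) (hVO : V ≠ O) (hVO' : V' ≠ O)
    (hXU : Par (𝒜.line X U) (𝒜.line X' U')) (hXV : Par (𝒜.line X V) (𝒜.line X' V'))
    (hEU : Par (𝒜.line E U) (𝒜.line E' U')) : Par (𝒜.line E V) (𝒜.line E' V') := by
  obtain ⟨n, hn, hln, hmn, hOn, Q, hQ, hQO⟩ :=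
    exists_third_line hl hm hlm hOl hOm hX hXO hV hVO
  -- `Q'` is the image of `Q` under the dilation that takes `X` to `X'`
  obtain ⟨Q', hQ', hQO', hXQ⟩ := exists_par_line hl hn hln hOl hOn hX hXO hX' hXO' hQ hQO
  have hUQ : Par (𝒜.line U Q) (𝒜.line U' Q') :=
    par_of_concurrent h𝒜 hm hl hn hlm.symm hln hmn hOm hOl hOn hU hU' hX hX' hQ hQ'
      hUO hUO' hXO hXO' hQO hQO' (by rwa [𝒜.line_comm U, 𝒜.line_comm U']) hXQ
  have hVQ : Par (𝒜.line V Q) (𝒜.line V' Q') :=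
    par_of_concurrent h𝒜 hm hl hn hlm.symm hln hmn hOm hOl hOn hV hV' hX hX' hQ hQ'
      hVO hVO' hXO hXO' hQO hQO' (by rwa [𝒜.line_comm V, 𝒜.line_comm V']) hXQ
  have hEQ : Par (𝒜.line E Q) (𝒜.line E' Q') :=
    par_of_concurrent h𝒜 hl hm hn hlm hmn hln hOl hOm hOn hE hE' hU hU' hQ hQ'
      hEO hEO' hUO hUO' hQO hQO' hEU hUQ
  exact par_of_concurrent h𝒜 hl hn hm hln hmn.symm hlm hOl hOn hOm hE hE' hQ hQ' hV hV'
    hEO hEO' hQO hQO' hVO hVO' hEQ (by rwa [𝒜.line_comm Q, 𝒜.line_comm Q'])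

/-! ### The multiplicative group of the line `OI` -/

variable {O I B₁ : Pt}

theorem mul_eq_of_isProduct (hOI : O ≠ I) (hB₁ : B₁ ∉ 𝒜.line O I)
    {A B C : 𝒜.line O I} (h : 𝒜.IsProduct O I B₁ A B C) :
    𝒜.mul hOI hB₁ A B = C :=
  (𝒜.existsUnique_product hOI hB₁ A B).unique (𝒜.mul_spec hOI hB₁ A B) h

theorem ne_of_notMem_line (hB₁ : B₁ ∉ 𝒜.line O I) : O ≠ B₁ := fun e =>
  hB₁ (e ▸ 𝒜.left_mem_line O I)

theorem line_ne_of_notMem (hB₁ : B₁ ∉ 𝒜.line O I) : 𝒜.line O I ≠ 𝒜.line O B₁ := fun e =>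
  hB₁ (e ▸ 𝒜.right_mem_line O B₁)

theorem notMem_line_of_ne (hOI : O ≠ I) (hB₁ : B₁ ∉ 𝒜.line O I)
    {X : Pt} (hX : X ∈ 𝒜.line O I) (hXO : X ≠ O) : X ∉ 𝒜.line O B₁ :=
  notMem_of_mem_ne (𝒜.line_mem hOI) (𝒜.line_mem (ne_of_notMem_line hB₁))
    (line_ne_of_notMem hB₁) (𝒜.left_mem_line O I) (𝒜.left_mem_line O B₁) hX hXO

/-- `A · B` is the image of `B` under the dilation with centre `O` that takes `I` to `A` and `B₁`
to `p`. -/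
theorem mul_eq_of_par (hOI : O ≠ I) (hB₁ : B₁ ∉ 𝒜.line O I)
    {A B C : 𝒜.line O I} (hA : (A : Pt) ≠ O) (hC : (C : Pt) ≠ O)
    {p : Pt} (hp : p ∈ 𝒜.line O B₁) (h₁ : Par (𝒜.line I B₁) (𝒜.line A p))
    (h₂ : Par (𝒜.line B₁ B) (𝒜.line p C)) : 𝒜.mul hOI hB₁ A B = C := by
  have hAp : (A : Pt) ≠ p := fun e => notMem_line_of_ne hOI hB₁ A.2 hA (e ▸ hp)
  have hCp : p ≠ (C : Pt) := fun e => notMem_line_of_ne hOI hB₁ C.2 hC (e ▸ hp)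
  have hIB : I ≠ B₁ := fun e => hB₁ (e ▸ 𝒜.right_mem_line O I)
  have hBB : (B : Pt) ≠ B₁ := fun e => hB₁ (e ▸ B.2)
  rw [𝒜.line_comm B₁] at h₂
  exact mul_eq_of_isProduct hOI hB₁ ⟨p, mem_parallelThrough h₁.symm hAp (𝒜.line_mem hIB), hp,
    mem_parallelThrough h₂.symm hCp (𝒜.line_mem hBB), C.2⟩

theorem exists_par_of_ne (hOI : O ≠ I) (hB₁ : B₁ ∉ 𝒜.line O I)
    {A : 𝒜.line O I} (hA : (A : Pt) ≠ O) :
    ∃ p ∈ 𝒜.line O B₁, p ≠ O ∧ Par (𝒜.line I B₁) (𝒜.line A p) :=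
  exists_par_line (𝒜.line_mem hOI) (𝒜.line_mem (ne_of_notMem_line hB₁))
    (line_ne_of_notMem hB₁) (𝒜.left_mem_line O I) (𝒜.left_mem_line O B₁)
    (𝒜.right_mem_line O I) hOI.symm A.2 hA (𝒜.right_mem_line O B₁) (ne_of_notMem_line hB₁).symm

/-- The image of `X ∈ OI` under the dilation with centre `O` that takes `p ∈ OB₁` to `q ∈ OB₁`. -/
theorem exists_par_of_mem (hOI : O ≠ I) (hB₁ : B₁ ∉ 𝒜.line O I)
    {p q : Pt} (hp : p ∈ 𝒜.line O B₁) (hpO : p ≠ O)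
    (hq : q ∈ 𝒜.line O B₁) (hqO : q ≠ O) {X : Pt} (hX : X ∈ 𝒜.line O I) (hXO : X ≠ O) :
    ∃ Y : 𝒜.line O I, (Y : Pt) ≠ O ∧ Par (𝒜.line p X) (𝒜.line q Y) := by
  obtain ⟨Y, hY, h⟩ := exists_par_line (𝒜.line_mem (ne_of_notMem_line hB₁)) (𝒜.line_mem hOI)
    (line_ne_of_notMem hB₁).symm (𝒜.left_mem_line O B₁) (𝒜.left_mem_line O I) hp hpO hq hqO
    hX hXO
  exact ⟨⟨Y, hY⟩, h⟩

/-- Converse to `mul_eq_of_par`: any auxiliary point `p` computes the product. -/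
theorem mul_ne_and_par (hOI : O ≠ I) (hB₁ : B₁ ∉ 𝒜.line O I)
    {A B : 𝒜.line O I} (hA : (A : Pt) ≠ O) (hB : (B : Pt) ≠ O) {p : Pt}
    (hp : p ∈ 𝒜.line O B₁) (hpO : p ≠ O) (h₁ : Par (𝒜.line I B₁) (𝒜.line A p)) :
    (𝒜.mul hOI hB₁ A B : Pt) ≠ O ∧
      Par (𝒜.line B₁ B) (𝒜.line p (𝒜.mul hOI hB₁ A B)) := by
  obtain ⟨C, hC, h₂⟩ := exists_par_of_mem hOI hB₁ (𝒜.right_mem_line O B₁)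
    (ne_of_notMem_line hB₁).symm hp hpO B.2 hB
  rw [mul_eq_of_par hOI hB₁ hA hC hp h₁ h₂]
  exact ⟨hC, h₂⟩

theorem mul_ne (hOI : O ≠ I) (hB₁ : B₁ ∉ 𝒜.line O I)
    {A B : 𝒜.line O I} (hA : (A : Pt) ≠ O) (hB : (B : Pt) ≠ O) :
    (𝒜.mul hOI hB₁ A B : Pt) ≠ O := by
  obtain ⟨p, hp, hpO, h₁⟩ := exists_par_of_ne hOI hB₁ hA
  exact (mul_ne_and_par hOI hB₁ hA hB hp hpO h₁).1

theorem mul_zero' (hOI : O ≠ I) (hB₁ : B₁ ∉ 𝒜.line O I)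
    {A B : 𝒜.line O I} (hB : (B : Pt) = O) : 𝒜.mul hOI hB₁ A B = B := by
  obtain ⟨p, hp, hp', -, -⟩ := 𝒜.mul_spec hOI hB₁ A B
  have lOB := 𝒜.line_mem (ne_of_notMem_line hB₁)
  -- `B = O`, so the parallel to `BB₁` through `p` is the line `OB₁` itself
  refine mul_eq_of_isProduct hOI hB₁ ⟨p, hp, hp', ?_, B.2⟩
  rw [hB, 𝒜.parallelThrough_eq lOB lOB hp' (Or.inl rfl)]
  exact 𝒜.left_mem_line O B₁

theorem one_mul' (hOI : O ≠ I) (hB₁ : B₁ ∉ 𝒜.line O I)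
    {B : 𝒜.line O I} (hB : (B : Pt) ≠ O) {J : 𝒜.line O I} (hJ : (J : Pt) = I) :
    𝒜.mul hOI hB₁ J B = B :=
  mul_eq_of_par hOI hB₁ (by rw [hJ]; exact hOI.symm) hB (𝒜.right_mem_line O B₁) (Or.inl (by rw [hJ]))
    (Or.inl rfl)

theorem mul_one' (hOI : O ≠ I) (hB₁ : B₁ ∉ 𝒜.line O I)
    {A : 𝒜.line O I} (hA : (A : Pt) ≠ O) {J : 𝒜.line O I} (hJ : (J : Pt) = I) :
    𝒜.mul hOI hB₁ A J = A := by
  obtain ⟨p, hp, -, h₁⟩ := exists_par_of_ne hOI hB₁ hA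
  refine mul_eq_of_par hOI hB₁ hA hA hp h₁ ?_
  rw [hJ, 𝒜.line_comm B₁, 𝒜.line_comm p]
  exact h₁

theorem mul_assoc' (hOI : O ≠ I) (hB₁ : B₁ ∉ 𝒜.line O I)
    (h𝒜 : 𝒜.IsDesarguesian) {A B : 𝒜.line O I} (hA : (A : Pt) ≠ O)
    (hB : (B : Pt) ≠ O) (C : 𝒜.line O I) :
    𝒜.mul hOI hB₁ (𝒜.mul hOI hB₁ A B) C = 𝒜.mul hOI hB₁ A (𝒜.mul hOI hB₁ B C) := by
  by_cases hC : (C : Pt) = O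
  · rw [mul_zero' hOI hB₁ hC, mul_zero' hOI hB₁ hC, mul_zero' hOI hB₁ hC]
  obtain ⟨p, hp, hpO, hAp⟩ := exists_par_of_ne hOI hB₁ hA
  obtain ⟨q, hq, hqO, hBq⟩ := exists_par_of_ne hOI hB₁ hB
  obtain ⟨hDO, hD⟩ := mul_ne_and_par hOI hB₁ hA hB hp hpO hAp
  obtain ⟨hEO, hE⟩ := mul_ne_and_par hOI hB₁ hB hC hq hqO hBq
  generalize 𝒜.mul hOI hB₁ A B = D at *
  generalize 𝒜.mul hOI hB₁ B C = E at *
  obtain ⟨r, hr, hrO, hDr⟩ := exists_par_of_ne hOI hB₁ hDO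
  obtain ⟨hFO, hF⟩ := mul_ne_and_par hOI hB₁ hDO hC hr hrO hDr
  generalize 𝒜.mul hOI hB₁ D C = F at *
  have ne {X : 𝒜.line O I} (hX : (X : Pt) ≠ O) {s : Pt} (hs : s ∈ 𝒜.line O B₁) : (X : Pt) ≠ s :=
    fun e => notMem_line_of_ne hOI hB₁ X.2 hX (e ▸ hs)
  have lIB := 𝒜.line_mem (fun e => hB₁ (e ▸ 𝒜.right_mem_line O I) : I ≠ B₁)
  have lCB := 𝒜.line_mem (ne hC (𝒜.right_mem_line O B₁)).symm
  -- the dilation that takes `B` to `D = A · B` takes `q` to `r`, `B₁` to `p` and `E` to `F`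
  have h₁ : Par (𝒜.line B q) (𝒜.line D r) :=
    hBq.symm.trans hDr (𝒜.line_mem (ne hB hq)) lIB (𝒜.line_mem (ne hDO hr))
  have h₂ : Par (𝒜.line q E) (𝒜.line r F) :=
    hE.symm.trans hF (𝒜.line_mem (ne hEO hq).symm) lCB (𝒜.line_mem (ne hFO hr).symm)
  refine (mul_eq_of_par hOI hB₁ hA hFO hp hAp ?_).symm
  rw [𝒜.line_comm B₁, 𝒜.line_comm p] at hD ⊢
  rw [𝒜.line_comm q, 𝒜.line_comm r] at h₂
  exact par_of_two_lines h𝒜 (𝒜.line_mem hOI) (𝒜.line_mem (ne_of_notMem_line hB₁))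
    (line_ne_of_notMem hB₁) (𝒜.left_mem_line O I) (𝒜.left_mem_line O B₁) B.2 D.2 E.2 F.2 hq hr
    (𝒜.right_mem_line O B₁) hp hB hDO hEO hFO hqO hrO (ne_of_notMem_line hB₁).symm hpO h₁ hD h₂

theorem exists_mul_right (hOI : O ≠ I) (hB₁ : B₁ ∉ 𝒜.line O I)
    {B : 𝒜.line O I} (hB : (B : Pt) ≠ O) :
    ∃ X : 𝒜.line O I, (X : Pt) ≠ O ∧ (𝒜.mul hOI hB₁ B X : Pt) = I := by
  obtain ⟨p, hp, hpO, h₁⟩ := exists_par_of_ne hOI hB₁ hB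
  obtain ⟨X, hXO, hX⟩ := exists_par_of_mem hOI hB₁ hp hpO (𝒜.right_mem_line O B₁)
    (ne_of_notMem_line hB₁).symm (𝒜.right_mem_line O I) hOI.symm
  refine ⟨X, hXO, ?_⟩
  rw [mul_eq_of_par hOI hB₁ (C := ⟨I, 𝒜.right_mem_line O I⟩) hB hOI.symm hp h₁ hX.symm]

theorem isInverse_inv (hOI : O ≠ I) (hB₁ : B₁ ∉ 𝒜.line O I)
    (h𝒜 : 𝒜.IsDesarguesian) {B : 𝒜.line O I} (hB : (B : Pt) ≠ O) :
    𝒜.IsInverse hOI hB₁ B (𝒜.inv hOI hB₁ B) := by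
  have h : ∃ X, 𝒜.IsInverse hOI hB₁ B X := by
    -- a right inverse `X` of `B` has a right inverse `Y` itself, and `B = B · (X · Y) = Y`
    obtain ⟨X, hXO, hX⟩ := exists_mul_right hOI hB₁ hB
    obtain ⟨Y, hYO, hY⟩ := exists_mul_right hOI hB₁ hXO
    have e := mul_assoc' hOI hB₁ h𝒜 hB hXO Y
    rw [one_mul' hOI hB₁ hYO hX, mul_one' hOI hB₁ hB hY] at e
    exact ⟨X, hX, e ▸ hY⟩
  unfold inv
  rw [dif_pos h]
  exact h.choose_spec

theorem IsInverse.ne (hOI : O ≠ I) (hB₁ : B₁ ∉ 𝒜.line O I)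
    {B X : 𝒜.line O I} (h : 𝒜.IsInverse hOI hB₁ B X) : (X : Pt) ≠ O := by
  intro hX
  have e := h.1
  rw [mul_zero' hOI hB₁ hX, hX] at e
  exact hOI e

theorem mul_left_cancel' (hOI : O ≠ I) (hB₁ : B₁ ∉ 𝒜.line O I)
    (h𝒜 : 𝒜.IsDesarguesian) {P A B : 𝒜.line O I} (hP : (P : Pt) ≠ O)
    (hB : (B : Pt) ≠ O) (h : 𝒜.mul hOI hB₁ P A = 𝒜.mul hOI hB₁ P B) : A = B := by
  have hA : (A : Pt) ≠ O := fun hA => mul_ne hOI hB₁ hP hB (by rw [← h, mul_zero' hOI hB₁ hA, hA])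
  have hi := isInverse_inv hOI hB₁ h𝒜 hP
  have hne := IsInverse.ne hOI hB₁ hi
  rw [← one_mul' hOI hB₁ hA hi.2, ← one_mul' hOI hB₁ hB hi.2, mul_assoc' hOI hB₁ h𝒜 hne hP,
    mul_assoc' hOI hB₁ h𝒜 hne hP, h]

/-- The identity `(P · B)⁻¹ · P = B⁻¹`. -/
theorem inv_mul_mul_self (hOI : O ≠ I) (hB₁ : B₁ ∉ 𝒜.line O I)
    (h𝒜 : 𝒜.IsDesarguesian) {P B : 𝒜.line O I} (hP : (P : Pt) ≠ O)
    (hB : (B : Pt) ≠ O) :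
    𝒜.mul hOI hB₁ (𝒜.inv hOI hB₁ (𝒜.mul hOI hB₁ P B)) P = 𝒜.inv hOI hB₁ B := by
  have hX := isInverse_inv hOI hB₁ h𝒜 hB
  have hY := isInverse_inv hOI hB₁ h𝒜 (mul_ne hOI hB₁ hP hB)
  have hYO := IsInverse.ne hOI hB₁ hY
  have hYP := mul_ne hOI hB₁ hYO hP
  have e := mul_assoc' hOI hB₁ h𝒜 hYP hB (𝒜.inv hOI hB₁ B)
  rw [mul_assoc' hOI hB₁ h𝒜 hYO hP, one_mul' hOI hB₁ (IsInverse.ne hOI hB₁ hX) hY.2,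
    mul_one' hOI hB₁ hYP hX.1] at e
  exact e.symm

end AffPlane

theorem mainTheorem9 {Pt : Type u} (𝒜 : AffPlane Pt) (h𝒜 : 𝒜.IsDesarguesian)
    (O I B₁ : Pt) (hOI : O ≠ I) (hB₁ : B₁ ∉ 𝒜.line O I)
    (P : 𝒜.line O I) (hP : (P : Pt) ≠ O) :
    ∀ A B : 𝒜.line O I, (B : Pt) ≠ O →
      -- both ratios are ratios in the sense of the definition
      (𝒜.IsInverse hOI hB₁ B (𝒜.inv hOI hB₁ B) ∧
        (𝒜.inversion hOI hB₁ P B : Pt) ≠ O ∧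
        𝒜.IsInverse hOI hB₁ (𝒜.inversion hOI hB₁ P B)
          (𝒜.inv hOI hB₁ (𝒜.inversion hOI hB₁ P B)) ∧
        (A ≠ B → 𝒜.inversion hOI hB₁ P A ≠ 𝒜.inversion hOI hB₁ P B)) ∧
      -- and they agree
      𝒜.ratio hOI hB₁ (𝒜.inversion hOI hB₁ P A) (𝒜.inversion hOI hB₁ P B)
        = 𝒜.mul hOI hB₁ (𝒜.inv hOI hB₁ B) A ∧
      𝒜.mul hOI hB₁ (𝒜.inv hOI hB₁ B) A = 𝒜.ratio hOI hB₁ A B := by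
  intro A B hB
  have hPB := AffPlane.mul_ne hOI hB₁ hP hB
  have hY := AffPlane.isInverse_inv hOI hB₁ h𝒜 hPB
  refine ⟨⟨AffPlane.isInverse_inv hOI hB₁ h𝒜 hB, hPB, hY,
    fun hAB h => hAB (AffPlane.mul_left_cancel' hOI hB₁ h𝒜 hP hB h)⟩, ?_, rfl⟩
  unfold AffPlane.ratio AffPlane.inversion
  rw [← AffPlane.mul_assoc' hOI hB₁ h𝒜 (AffPlane.IsInverse.ne hOI hB₁ hY) hP,
    AffPlane.inv_mul_mul_self hOI hB₁ h𝒜 hP hB]
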